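/- Let $\Xi$ (edge marks, totally ordered) and $\Theta$ (vertex marks) be finite sets. A \emph{marked graph} is a simple graph $G$ in which every vertex $v$ has a mark $\tau_G(v)\in\Theta$ and every edge $\{v,w\}$ has a mark $\xi_G(v,w)\in\Xi$ towards $w$ and a mark $\xi_G(w,v)\in\Xi$ towards $v$. Let $\bar{\mathcal G}_*$ be the space of isomorphism classes $[G,o]$ of rooted, connected, locally finite marked graphs on finite or countably infinite vertex sets, with the local metric $d_*([G,o],[G',o'])=1/(1+h_*)$, where $h_*$ is the largest $h\ge 0$ such that the $h$-neighborhoods of the roots are isomorphic as rooted marked graphs ($h_*=0$ if there is no such $h$; $d_*=0$ if they are isomorphic for all $h$), and its Borel $\sigma$-algebra. Let $\bar{\mathcal T}_*\subset\bar{\mathcal G}_*$ be the set of classes of rooted trees. Let $\bar{\mathcal G}_{**}$ be the analogous space of isomorphism classes $[G,o,v]$ of connected marked graphs with an ordered pair of distinguished vertices, with the Borel $\sigma$-algebra of the local topology. A Borel probability measure $\mu$ on $\bar{\mathcal G}_*$ is \emph{unimodular} if $\int\sum_{v\in V(G)}f([G,o,v])\,d\mu([G,o])=\int\sum_{v\in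 V(G)}f([G,v,o])\,d\mu([G,o])$ for all measurable $f:\bar{\mathcal G}_{**}\to[0,\infty)$. For such $\mu$ let $\deg(\mu)$ be the expected degree of the root; let $\deg_{x,x'}(\mu)$ be the expected number of neighbors $v$ of the root $o$ with $\xi_G(v,o)=x$ and $\xi_G(o,v)=x'$; and let $\Pi_\theta(\mu)$ be the probability that the root has mark $\theta$. Put $\vec{\deg}(\mu)=(\deg_{x,x'}(\mu))_{x,x'\in\Xi}$ and $\vec\Pi(\mu)=(\Pi_\theta(\mu))_{\theta\in\Theta}$. For a marked graph $G$ on $[n]$ let $U(G)=\frac1n\sum_{v\in[n]}\delta_{[G,v]}$, where $[G,v]$ is the class of the connected component of $v$ rooted at $v$. Let $m_G(x,x')$ be the number of edges of $G$ whose two marks are $x$ and $x'$ (in either orientation), and let $u_G(\theta)$ be the number of vertices with mark $\theta$. Let $\vec m^{(n)}=(m^{(n)}(x,x'))_{x,x'\in\Xi}$ and $\vec u^{(n)}=(u^{(n)}(\theta))_{\theta\in\Theta}$, $n\ge1$, be vectors of nonnegative integers with $m^{(n)}(x,x')=m^{(n)}(x',x)$, and let $\|\vec m^{(n)}\|_1=\sum_{x\le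 x'}m^{(n)}(x,x')$. They are \emph{adapted} to $(\vec d,Q)$ if $\|\vec m^{(n)}\|_1\le\binom n2$ and $\sum_\theta u^{(n)}(\theta)=n$ for all $n$; $m^{(n)}(x,x)/n\to d_{x,x}/2$ for all $x$; $m^{(n)}(x,x')/n\to d_{x,x'}$ for all $x\ne x'$; $u^{(n)}(\theta)/n\to q_\theta$ for all $\theta$; $d_{x,x'}=0$ implies $m^{(n)}(x,x')=0$ for all $n$; and $q_\theta=0$ implies $u^{(n)}(\theta)=0$ for all $n$. For $\epsilon>0$ let $\mathcal G^{(n)}_{\vec m^{(n)},\vec u^{(n)}}(\mu,\epsilon)$ be the set of marked graphs $G$ on $[n]$ with $m_G=\vec m^{(n)}$, $u_G=\vec u^{(n)}$ and $d_{\mathrm{LP}}(U(G),\mu)<\epsilon$, where $d_{\mathrm{LP}}$ is the Lévy–Prokhorov distance. For $(\vec m^{(n)},\vec u^{(n)})$ adapted to $(\vec d,Q)$, the \emph{upper BC entropy} of $\mu$ is $$\overline\Sigma_{\vec d,Q}(\mu)\big|_{(\vec m^{(n)},\vec u^{(n)})}=\lim_{\epsilon\downarrow0}\ \limsup_{n\to\infty}\frac{\log\bigl|\mathcal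 G^{(n)}_{\vec m^{(n)},\vec u^{(n)}}(\mu,\epsilon)\bigr|-\|\vec m^{(n)}\|_1\log n}{n}\in[-\infty,\infty],\qquad \log 0=-\infty .$$ \textbf{Proposition.} Let $\mu$ be a unimodular Borel probability measure on $\bar{\mathcal G}_*$ that is supported on $\bar{\mathcal T}_*$, with $0<\deg(\mu)<\infty$ and $\mathbb E_\mu[\deg_T(o)\log\deg_T(o)]=\infty$ (where $0\log0=0$). Then, for all sequences $\vec m^{(n)},\vec u^{(n)}$ such that $(\vec m^{(n)},\vec u^{(n)})$ is adapted to $(\vec{\deg}(\mu),\vec\Pi(\mu))$, $$\overline\Sigma_{\vec{\deg}(\mu),\vec\Pi(\mu)}(\mu)\big|_{(\vec m^{(n)},\vec u^{(n)})}=-\infty .$$ -/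

import Mathlib

open MeasureTheory Filter Topology
open scoped ENNReal NNReal

noncomputable section

namespace MarkedBC

/-! ### Marked graphs -/

/-- A simple marked graph on the vertex set `V`, with edge marks in `Ξ` and vertex marks in `Θ`.
`emark v w = some x` means that `v` and `w` are adjacent and that the mark of the edge towards `w`
is `x`; `emark v w = none` means that `v` and `w` are not adjacent. -/
@[ext]
structure MarkedGraph (V : Type*) (Ξ : Type*) (Θ : Type*) where
  graph : SimpleGraph V
  vmark : V → Θ
  emark : V → V → Option Ξ
  emark_isSome : ∀ v w, (emark v w).isSome ↔ graph.Adj v w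

variable {V W X : Type*} {Ξ : Type*} {Θ : Type*}

namespace MarkedGraph

/-- There are finitely many marked graphs on a finite vertex set with finite mark sets. -/
instance [Finite V] [Finite Ξ] [Finite Θ] : Finite (MarkedGraph V Ξ Θ) := by
  have : Finite (Option Ξ) := inferInstance
  refine Finite.of_injective
    (fun G : MarkedGraph V Ξ Θ => ((G.vmark, G.emark) : (V → Θ) × (V → V → Option Ξ))) ?_
  intro G H h
  have h1 : G.vmark = H.vmark := congrArg Prod.fst h
  have h2 : G.emark = H.emark := congrArg Prod.snd h
  refine MarkedGraph.ext ?_ h1 h2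
  ext v w
  rw [← G.emark_isSome, ← H.emark_isSome, h2]

/-- The marked subgraph induced on a set of vertices. -/
def induce (G : MarkedGraph V Ξ Θ) (s : Set V) : MarkedGraph s Ξ Θ where
  graph := G.graph.induce s
  vmark v := G.vmark v
  emark v w := G.emark v w
  emark_isSome v w := G.emark_isSome v w

/-- Isomorphisms of marked graphs: bijections preserving adjacency and all marks. -/
structure Iso (G : MarkedGraph V Ξ Θ) (H : MarkedGraph W Ξ Θ) where
  toEquiv : V ≃ W
  vmark_eq : ∀ v, H.vmark (toEquiv v) = G.vmark v
  emark_eq : ∀ v w, H.emark (toEquiv v) (toEquiv w) = G.emark v w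

namespace Iso

variable {G : MarkedGraph V Ξ Θ} {H : MarkedGraph W Ξ Θ} {K : MarkedGraph X Ξ Θ}

/-- The identity isomorphism. -/
def refl (G : MarkedGraph V Ξ Θ) : Iso G G := ⟨Equiv.refl V, fun _ => rfl, fun _ _ => rfl⟩

/-- The inverse isomorphism. -/
def symm (φ : Iso G H) : Iso H G where
  toEquiv := φ.toEquiv.symm
  vmark_eq v := by rw [← φ.vmark_eq, Equiv.apply_symm_apply]
  emark_eq v w := by rw [← φ.emark_eq, Equiv.apply_symm_apply, Equiv.apply_symm_apply]

/-- The composition of isomorphisms. -/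
def trans (φ : Iso G H) (ψ : Iso H K) : Iso G K where
  toEquiv := φ.toEquiv.trans ψ.toEquiv
  vmark_eq v := by simp [ψ.vmark_eq, φ.vmark_eq]
  emark_eq v w := by simp [ψ.emark_eq, φ.emark_eq]

/-- The underlying isomorphism of simple graphs. -/
def toGraphIso (φ : Iso G H) : G.graph ≃g H.graph where
  toEquiv := φ.toEquiv
  map_rel_iff' {v w} := by rw [← H.emark_isSome, ← G.emark_isSome, φ.emark_eq]

theorem dist_le (φ : Iso G H) (hH : H.graph.Connected) (v w : V) :
    G.graph.dist v w ≤ H.graph.dist (φ.toEquiv v) (φ.toEquiv w) := by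
  obtain ⟨p, hp⟩ := hH.exists_walk_length_eq_dist (φ.toEquiv v) (φ.toEquiv w)
  have q := (p.map φ.symm.toGraphIso.toHom)
  have := SimpleGraph.dist_le (p.map φ.symm.toGraphIso.toHom)
  rw [SimpleGraph.Walk.length_map, hp] at this
  have e : ∀ u, φ.symm.toGraphIso.toHom (φ.toEquiv u) = u := fun u =>
    φ.toEquiv.symm_apply_apply u
  rwa [e, e] at this

theorem dist_eq (φ : Iso G H) (hG : G.graph.Connected) (hH : H.graph.Connected) (v w : V) :
    H.graph.dist (φ.toEquiv v) (φ.toEquiv w) = G.graph.dist v w := by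
  refine le_antisymm ?_ (φ.dist_le hH v w)
  have := φ.symm.dist_le hG (φ.toEquiv v) (φ.toEquiv w)
  simpa [symm] using this

/-- Restriction of an isomorphism to induced subgraphs on corresponding vertex sets. -/
def restrict (φ : Iso G H) {s : Set V} {t : Set W} (h : ∀ v, v ∈ s ↔ φ.toEquiv v ∈ t) :
    Iso (G.induce s) (H.induce t) where
  toEquiv := φ.toEquiv.subtypeEquiv h
  vmark_eq v := φ.vmark_eq v
  emark_eq v w := φ.emark_eq v w

end Iso

/-- The number `m_G(x, x')` of (unordered) edges of `G` carrying the marks `x` and `x'` towards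
their two endpoints, in either orientation. -/
def edgeMarkCount (G : MarkedGraph V Ξ Θ) (x x' : Ξ) : ℕ :=
  {e : Sym2 V | ∃ v w, e = s(v, w) ∧ G.emark v w = some x ∧ G.emark w v = some x'}.ncard

/-- The number `u_G(θ)` of vertices of `G` with mark `θ`. -/
def vertexMarkCount (G : MarkedGraph V Ξ Θ) (θ : Θ) : ℕ :=
  {v : V | G.vmark v = θ}.ncard

end MarkedGraph

/-! ### Rooted marked graphs and their isomorphism classes -/

/-- A rooted connected marked graph: a connected locally finite marked graph on a finite or
countably infinite vertex set with a distinguished vertex. -/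
structure RootedGraph (Ξ : Type*) (Θ : Type*) where
  V : Type
  [countable : Countable V]
  G : MarkedGraph V Ξ Θ
  connected : G.graph.Connected
  locallyFinite : ∀ v, (G.graph.neighborSet v).Finite
  root : V

/-- A connected marked graph with an ordered pair of (not necessarily distinct) vertices. -/
structure BirootedGraph (Ξ : Type*) (Θ : Type*) extends RootedGraph Ξ Θ where
  second : V

attribute [instance] RootedGraph.countable

theorem finite_neighborSet_induce {G : SimpleGraph V} (h : ∀ v, (G.neighborSet v).Finite)
    (s : Set V) (v : s) : ((G.induce s).neighborSet v).Finite :=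
  Set.Finite.of_finite_image ((h v).subset (by rintro _ ⟨w, hw, rfl⟩; exact hw))
    (Subtype.val_injective.injOn (s := (G.induce s).neighborSet v))

/-- Every vertex of a ball around `o` is joined to `o` by a shortest walk inside the ball. -/
theorem exists_walk_ball {G : SimpleGraph V} (hG : G.Connected) (o : V) (h : ℕ) (v : V)
    (hv : G.dist o v ≤ h) :
    ∃ p : (G.induce {w | G.dist o w ≤ h}).Walk ⟨o, by simp⟩ ⟨v, hv⟩,
      p.length = G.dist o v := by
  classical
  obtain ⟨p, hp⟩ := hG.exists_walk_length_eq_dist o v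
  have hs : ∀ x ∈ p.support, x ∈ {w | G.dist o w ≤ h} := by
    intro x hx
    have h1 := SimpleGraph.dist_le (p.takeUntil x hx)
    have h2 := p.length_takeUntil_le_length hx
    simp only [Set.mem_ofPred_eq]
    omega
  refine ⟨p.induce _ hs, ?_⟩
  have e := congrArg SimpleGraph.Walk.length (p.map_induce hs)
  exact ((SimpleGraph.Walk.length_map _ _).symm.trans e).trans hp

theorem connected_ball {G : SimpleGraph V} (hG : G.Connected) (o : V) (h : ℕ) :
    (G.induce {w | G.dist o w ≤ h}).Connected := by
  have : Nonempty {w | G.dist o w ≤ h} := ⟨⟨o, by simp⟩⟩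
  refine ⟨fun a b => ?_⟩
  obtain ⟨p, -⟩ := exists_walk_ball hG o h a.1 a.2
  obtain ⟨q, -⟩ := exists_walk_ball hG o h b.1 b.2
  exact (p.reverse.append q).reachable

theorem dist_ball {G : SimpleGraph V} (hG : G.Connected) (o : V) (h : ℕ)
    (v : {w | G.dist o w ≤ h}) :
    (G.induce {w | G.dist o w ≤ h}).dist ⟨o, by simp⟩ v = G.dist o v := by
  apply le_antisymm
  · obtain ⟨p, hp⟩ := exists_walk_ball hG o h v.1 v.2
    exact hp ▸ SimpleGraph.dist_le p
  · obtain ⟨p, hp⟩ := (connected_ball hG o h).exists_walk_length_eq_dist ⟨o, by simp⟩ v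
    rw [← hp, ← SimpleGraph.Walk.length_map (SimpleGraph.Embedding.induce _).toHom p]
    exact SimpleGraph.dist_le _

namespace RootedGraph

/-- Rooted isomorphism. -/
def Equivalent (R S : RootedGraph Ξ Θ) : Prop :=
  ∃ φ : MarkedGraph.Iso R.G S.G, φ.toEquiv R.root = S.root

instance setoid (Ξ : Type*) (Θ : Type*) : Setoid (RootedGraph Ξ Θ) where
  r := Equivalent
  iseqv :=
    { refl := fun R => ⟨.refl R.G, rfl⟩
      symm := by
        rintro R S ⟨φ, h⟩
        exact ⟨φ.symm, by rw [← h]; exact φ.toEquiv.symm_apply_apply _⟩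
      trans := by
        rintro R S T ⟨φ, h⟩ ⟨ψ, k⟩
        exact ⟨φ.trans ψ, by rw [← k, ← h]; rfl⟩ }

/-- The `h`-neighborhood of the root: the subgraph induced on the vertices at distance at most `h`
from the root. -/
def ball (R : RootedGraph Ξ Θ) (h : ℕ) : RootedGraph Ξ Θ where
  V := {v | R.G.graph.dist R.root v ≤ h}
  G := R.G.induce {v | R.G.graph.dist R.root v ≤ h}
  connected := connected_ball R.connected R.root h
  locallyFinite := finite_neighborSet_induce R.locallyFinite _
  root := ⟨R.root, by simp⟩

end RootedGraph

namespace BirootedGraph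

/-- Isomorphism preserving both distinguished vertices. -/
def Equivalent (R S : BirootedGraph Ξ Θ) : Prop :=
  ∃ φ : MarkedGraph.Iso R.G S.G, φ.toEquiv R.root = S.root ∧ φ.toEquiv R.second = S.second

instance setoid (Ξ : Type*) (Θ : Type*) : Setoid (BirootedGraph Ξ Θ) where
  r := Equivalent
  iseqv :=
    { refl := fun R => ⟨.refl R.G, rfl, rfl⟩
      symm := by
        rintro R S ⟨φ, h, k⟩
        exact ⟨φ.symm, by rw [← h]; exact φ.toEquiv.symm_apply_apply _,
          by rw [← k]; exact φ.toEquiv.symm_apply_apply _⟩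
      trans := by
        rintro R S T ⟨φ, h, k⟩ ⟨ψ, h', k'⟩
        exact ⟨φ.trans ψ, by rw [← h', ← h]; rfl, by rw [← k', ← k]; rfl⟩ }

/-- The distance between the two distinguished vertices. -/
def gap (R : BirootedGraph Ξ Θ) : ℕ := R.G.graph.dist R.root R.second

/-- The neighborhood of the first distinguished vertex whose radius exceeds the distance to the
second distinguished vertex by `h`; it contains both distinguished vertices. -/
def ball (R : BirootedGraph Ξ Θ) (h : ℕ) : BirootedGraph Ξ Θ where
  toRootedGraph := R.toRootedGraph.ball (R.gap + h)
  second := ⟨R.second, Nat.le_add_right _ _⟩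

end BirootedGraph

/-- The set of isomorphism classes `[G, o]` of rooted marked graphs. -/
def GStar (Ξ : Type*) (Θ : Type*) := Quotient (RootedGraph.setoid Ξ Θ)

/-- The set of isomorphism classes `[G, o, v]` of marked connected graphs with two distinguished
vertices. -/
def GStarStar (Ξ : Type*) (Θ : Type*) := Quotient (BirootedGraph.setoid Ξ Θ)

/-- The isomorphism class of a rooted connected marked graph. -/
def RootedGraph.toClass (R : RootedGraph Ξ Θ) : GStar Ξ Θ := Quotient.mk _ R

/-- The isomorphism class of a connected marked graph with two distinguished vertices. -/
def BirootedGraph.toClass (R : BirootedGraph Ξ Θ) : GStarStar Ξ Θ := Quotient.mk _ R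

theorem RootedGraph.ball_congr {R S : RootedGraph Ξ Θ} (h : ℕ) (e : R ≈ S) :
    R.ball h ≈ S.ball h := by
  obtain ⟨φ, hφ⟩ := e
  refine ⟨φ.restrict fun v => ?_, Subtype.ext hφ⟩
  simp only [Set.mem_ofPred_eq]
  rw [← hφ, φ.dist_eq R.connected S.connected]

theorem RootedGraph.ball_ball (R : RootedGraph Ξ Θ) {h k : ℕ} (hk : h ≤ k) :
    (R.ball k).ball h ≈ R.ball h := by
  have key : ∀ v : (R.ball k).V,
      (R.ball k).G.graph.dist (R.ball k).root v = R.G.graph.dist R.root v.1 :=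
    fun v => dist_ball R.connected R.root k v
  have h1 : ∀ v : (R.ball h).V, R.G.graph.dist R.root v.1 ≤ h := fun v => v.2
  have h2 : ∀ v : ((R.ball k).ball h).V,
      (R.ball k).G.graph.dist (R.ball k).root v.1 ≤ h := fun v => v.2
  exact ⟨⟨⟨fun v => ⟨v.1.1, (key v.1).symm.le.trans (h2 v)⟩,
    fun v => ⟨⟨v.1, (h1 v).trans hk⟩, (key ⟨v.1, (h1 v).trans hk⟩).le.trans (h1 v)⟩,
    fun v => rfl, fun v => rfl⟩, fun v => rfl, fun v w => rfl⟩, rfl⟩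

theorem BirootedGraph.gap_congr {R S : BirootedGraph Ξ Θ} (e : R ≈ S) : R.gap = S.gap := by
  obtain ⟨φ, hφ, hψ⟩ := e
  unfold gap
  rw [← hφ, ← hψ, φ.dist_eq R.connected S.connected]

theorem BirootedGraph.gap_ball (R : BirootedGraph Ξ Θ) (h : ℕ) : (R.ball h).gap = R.gap :=
  dist_ball R.connected R.root (R.gap + h) ⟨R.second, Nat.le_add_right _ _⟩

theorem BirootedGraph.ball_congr {R S : BirootedGraph Ξ Θ} (h : ℕ) (e : R ≈ S) :
    R.ball h ≈ S.ball h := by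
  have hg := gap_congr e
  obtain ⟨φ, hφ, hψ⟩ := e
  refine ⟨φ.restrict fun v => ?_, Subtype.ext hφ, Subtype.ext hψ⟩
  simp only [Set.mem_ofPred_eq]
  rw [← hφ, φ.dist_eq R.connected S.connected, hg]

theorem BirootedGraph.ball_ball (R : BirootedGraph Ξ Θ) {h k : ℕ} (hk : h ≤ k) :
    (R.ball k).ball h ≈ R.ball h := by
  have key : ∀ v : (R.ball k).V,
      (R.ball k).G.graph.dist (R.ball k).root v = R.G.graph.dist R.root v.1 :=
    fun v => dist_ball R.connected R.root (R.gap + k) v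
  have hg := R.gap_ball k
  have hk' : R.gap + h ≤ R.gap + k := by omega
  have h1 : ∀ v : (R.ball h).V, R.G.graph.dist R.root v.1 ≤ R.gap + h := fun v => v.2
  have h2 : ∀ v : ((R.ball k).ball h).V,
      (R.ball k).G.graph.dist (R.ball k).root v.1 ≤ R.gap + h := fun v => by
    rw [← hg]; exact v.2
  have h3 : ∀ v : (R.ball h).V, (R.ball k).G.graph.dist (R.ball k).root
      (⟨v.1, (h1 v).trans hk'⟩ : (R.ball k).V) ≤ (R.ball k).gap + h := fun v => by
    rw [hg]; exact (key ⟨v.1, (h1 v).trans hk'⟩).le.trans (h1 v)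
  exact ⟨⟨⟨fun v => ⟨v.1.1, (key v.1).symm.le.trans (h2 v)⟩,
    fun v => ⟨⟨v.1, (h1 v).trans hk'⟩, h3 v⟩,
    fun v => rfl, fun v => rfl⟩, fun v => rfl, fun v w => rfl⟩, rfl, rfl⟩

/-! ### The local topology -/

open Classical in
/-- The local distance attached to a family of truncations `t h`, `h ∈ ℕ`: it is `1 / (1 + h_*)`,
where `h_*` is the largest `h` such that the truncations at depth `h` agree (`h_* = 0` if there is
none), and `0` if all truncations agree. -/
def truncDist {X : Type*} (t : ℕ → X → X) (x y : X) : ℝ :=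
  if ∀ h, t h x = t h y then 0 else 1 / (1 + (sSup {h : ℕ | t h x = t h y} : ℕ))

section truncDist

variable {X : Type*} {t : ℕ → X → X}

theorem truncDist_self (x : X) : truncDist t x x = 0 := by simp [truncDist]

theorem truncDist_congr {a b c d : X} (e : ∀ h, t h a = t h b ↔ t h c = t h d) :
    truncDist t a b = truncDist t c d := by
  have es : {h : ℕ | t h a = t h b} = {h : ℕ | t h c = t h d} := Set.ext e
  unfold truncDist
  by_cases hab : ∀ h, t h a = t h b
  · rw [if_pos hab, if_pos fun h => (e h).1 (hab h)]
  · rw [if_neg hab, if_neg fun H => hab fun h => (e h).2 (H h), es]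

theorem truncDist_comm (x y : X) : truncDist t x y = truncDist t y x :=
  truncDist_congr fun _ => eq_comm

theorem truncDist_triangle (ht : ∀ h k, h ≤ k → ∀ x y, t k x = t k y → t h x = t h y)
    (x y z : X) : truncDist t x z ≤ truncDist t x y + truncDist t y z := by
  have nonneg : ∀ a b, 0 ≤ truncDist t a b := by
    intro a b; unfold truncDist; split_ifs <;> positivity
  have bdd : ∀ a b, ¬ (∀ h, t h a = t h b) → BddAbove {h : ℕ | t h a = t h b} := by
    intro a b hab
    push Not at hab
    obtain ⟨k, hk⟩ := hab
    refine ⟨k, fun h hh => ?_⟩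
    by_contra hlt
    exact hk (ht k h (by omega) a b hh)
  by_cases hxy : ∀ h, t h x = t h y
  · have : truncDist t x z = truncDist t y z :=
      truncDist_congr fun h => by rw [hxy h]
    rw [this]; linarith [nonneg x y]
  by_cases hyz : ∀ h, t h y = t h z
  · have : truncDist t x z = truncDist t x y :=
      truncDist_congr fun h => by rw [hyz h]
    rw [this]; linarith [nonneg y z]
  by_cases hxz : ∀ h, t h x = t h z
  · have : truncDist t x z = 0 := by simp only [truncDist, hxz, implies_true, if_true]
    rw [this]; linarith [nonneg x y, nonneg y z]
  have main : sSup {h : ℕ | t h x = t h y} ≤ sSup {h : ℕ | t h x = t h z} ∨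
      sSup {h : ℕ | t h y = t h z} ≤ sSup {h : ℕ | t h x = t h z} := by
    by_contra hcon
    push Not at hcon
    obtain ⟨h1, h2⟩ := hcon
    have n1 : {h : ℕ | t h x = t h y}.Nonempty := by
      by_contra he; rw [Set.not_nonempty_iff_eq_empty] at he; simp [he] at h1
    have n2 : {h : ℕ | t h y = t h z}.Nonempty := by
      by_contra he; rw [Set.not_nonempty_iff_eq_empty] at he; simp [he] at h2
    have m1 := Nat.sSup_mem n1 (bdd x y hxy)
    have m2 := Nat.sSup_mem n2 (bdd y z hyz)
    have k1 := ht _ _ h1 x y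
    set a := sSup {h : ℕ | t h x = t h y}
    set b := sSup {h : ℕ | t h y = t h z}
    have m : t (min a b) x = t (min a b) z :=
      (ht _ _ (min_le_left a b) _ _ m1).trans (ht _ _ (min_le_right a b) _ _ m2)
    have := le_csSup (bdd x z hxz) m
    omega
  have anti : ∀ a b : ℕ, a ≤ b → (1 : ℝ) / (1 + (b : ℕ)) ≤ 1 / (1 + (a : ℕ)) := by
    intro a b hab
    have : (a : ℝ) ≤ b := by exact_mod_cast hab
    gcongr
  have exz : truncDist t x z = 1 / (1 + (sSup {h : ℕ | t h x = t h z} : ℕ)) := if_neg hxz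
  have exy : truncDist t x y = 1 / (1 + (sSup {h : ℕ | t h x = t h y} : ℕ)) := if_neg hxy
  have eyz : truncDist t y z = 1 / (1 + (sSup {h : ℕ | t h y = t h z} : ℕ)) := if_neg hyz
  rcases main with hm | hm
  · have := anti _ _ hm
    rw [← exz, ← exy] at this
    linarith [nonneg y z]
  · have := anti _ _ hm
    rw [← exz, ← eyz] at this
    linarith [nonneg x y]

end truncDist

/-- The class `[G, o]_h` of the `h`-neighborhood of the root. -/
def GStar.trunc (h : ℕ) : GStar Ξ Θ → GStar Ξ Θ :=
  Quotient.map (fun R => R.ball h) fun _ _ e => RootedGraph.ball_congr h e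

/-- The class of the neighborhood of the first distinguished vertex whose radius exceeds the
distance to the second one by `h`. -/
def GStarStar.trunc (h : ℕ) : GStarStar Ξ Θ → GStarStar Ξ Θ :=
  Quotient.map (fun R => R.ball h) fun _ _ e => BirootedGraph.ball_congr h e

theorem GStar.trunc_trunc {h k : ℕ} (hk : h ≤ k) (g : GStar Ξ Θ) :
    (g.trunc k).trunc h = g.trunc h := by
  induction g using Quotient.inductionOn with
  | h R => exact Quotient.sound (R.ball_ball hk)

theorem GStarStar.trunc_trunc {h k : ℕ} (hk : h ≤ k) (g : GStarStar Ξ Θ) :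
    (g.trunc k).trunc h = g.trunc h := by
  induction g using Quotient.inductionOn with
  | h R => exact Quotient.sound (R.ball_ball hk)

/-- The local metric `d_*` on the space of rooted marked graphs. -/
instance : PseudoMetricSpace (GStar Ξ Θ) where
  dist := truncDist GStar.trunc
  dist_self := truncDist_self
  dist_comm := truncDist_comm
  dist_triangle := truncDist_triangle fun h k hk x y e => by
    rw [← x.trunc_trunc hk, e, y.trunc_trunc hk]

/-- The local metric on the space of marked graphs with two distinguished vertices. -/
instance : PseudoMetricSpace (GStarStar Ξ Θ) where
  dist := truncDist GStarStar.trunc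
  dist_self := truncDist_self
  dist_comm := truncDist_comm
  dist_triangle := truncDist_triangle fun h k hk x y e => by
    rw [← x.trunc_trunc hk, e, y.trunc_trunc hk]

instance : MeasurableSpace (GStar Ξ Θ) := borel _
instance : BorelSpace (GStar Ξ Θ) := ⟨rfl⟩
instance : MeasurableSpace (GStarStar Ξ Θ) := borel _
instance : BorelSpace (GStarStar Ξ Θ) := ⟨rfl⟩

/-- The set of isomorphism classes of rooted marked trees. -/
def TStar (Ξ : Type*) (Θ : Type*) : Set (GStar Ξ Θ) :=
  {g | ∃ R : RootedGraph Ξ Θ, R.toClass = g ∧ R.G.graph.IsTree}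

/-! ### Unimodularity -/

/-- The sum of `f [G, o, v]` over the vertices `v` of `G`, as a function of `[G, o]`. -/
def sumFrom (f : GStarStar Ξ Θ → ℝ≥0) : GStar Ξ Θ → ℝ≥0∞ :=
  Quotient.lift
    (fun R => ∑' v : R.V, (f (BirootedGraph.toClass ⟨R, v⟩) : ℝ≥0∞)) <| by
    rintro R S ⟨φ, hφ⟩
    refine Eq.trans ?_ (φ.toEquiv.tsum_eq _)
    refine tsum_congr fun v => ?_
    congr 2
    exact Quotient.sound ⟨φ, hφ, rfl⟩

/-- The sum of `f [G, v, o]` over the vertices `v` of `G`, as a function of `[G, o]`. -/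
def sumTo (f : GStarStar Ξ Θ → ℝ≥0) : GStar Ξ Θ → ℝ≥0∞ :=
  Quotient.lift
    (fun R => ∑' v : R.V, (f (BirootedGraph.toClass ⟨{ R with root := v }, R.root⟩) : ℝ≥0∞)) <| by
    rintro R S ⟨φ, hφ⟩
    refine Eq.trans ?_ (φ.toEquiv.tsum_eq _)
    refine tsum_congr fun v => ?_
    congr 2
    exact Quotient.sound ⟨φ, rfl, hφ⟩

/-- A measure on the space of rooted marked graphs is unimodular if it satisfies the mass transport
principle. -/
def Unimodular (μ : Measure (GStar Ξ Θ)) : Prop :=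
  ∀ f : GStarStar Ξ Θ → ℝ≥0, Measurable f → ∫⁻ g, sumFrom f g ∂μ = ∫⁻ g, sumTo f g ∂μ

/-! ### Degrees and root marks -/

theorem ncard_eq_of_equiv {V W : Type*} (e : V ≃ W) (s : Set V) (t : Set W)
    (h : ∀ v, v ∈ s ↔ e v ∈ t) : s.ncard = t.ncard := by
  rw [← Set.ncard_image_of_injective s e.injective]
  congr 1
  ext w
  constructor
  · rintro ⟨v, hv, rfl⟩
    exact (h v).1 hv
  · intro hw
    exact ⟨e.symm w, (h _).2 (by simpa using hw), by simp⟩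

/-- The degree of the root. -/
def deg : GStar Ξ Θ → ℕ :=
  Quotient.lift (fun R => (R.G.graph.neighborSet R.root).ncard) <| by
    rintro R S ⟨φ, hφ⟩
    refine ncard_eq_of_equiv φ.toEquiv _ _ fun v => ?_
    simp only [SimpleGraph.mem_neighborSet]
    rw [← hφ, ← R.G.emark_isSome, ← S.G.emark_isSome, φ.emark_eq]

/-- The number of neighbors `v` of the root `o` such that the edge between `v` and `o` has mark `x`
towards `o` and mark `x'` towards `v`. -/
def degMark (x x' : Ξ) : GStar Ξ Θ → ℕ :=
  Quotient.lift
    (fun R => {v | R.G.emark v R.root = some x ∧ R.G.emark R.root v = some x'}.ncard) <| by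
    rintro R S ⟨φ, hφ⟩
    refine ncard_eq_of_equiv φ.toEquiv _ _ fun v => ?_
    simp only [Set.mem_ofPred_eq]
    rw [← hφ, φ.emark_eq, φ.emark_eq]

/-- The mark of the root. -/
def rootMark : GStar Ξ Θ → Θ :=
  Quotient.lift (fun R => R.G.vmark R.root) <| by
    rintro R S ⟨φ, hφ⟩
    rw [← hφ, φ.vmark_eq]

/-- The expected degree `deg(μ)` of the root. -/
def meanDeg (μ : Measure (GStar Ξ Θ)) : ℝ≥0∞ := ∫⁻ g, (deg g : ℝ≥0∞) ∂μ

/-- The vector of the expected degrees `deg_{x,x'}(μ)`. -/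
def meanDegVec (μ : Measure (GStar Ξ Θ)) (x x' : Ξ) : ℝ :=
  (∫⁻ g, (degMark x x' g : ℝ≥0∞) ∂μ).toReal

/-- The probability vector of the root mark. -/
def rootMarkLaw (μ : Measure (GStar Ξ Θ)) (θ : Θ) : ℝ := (μ {g | rootMark g = θ}).toReal

/-- The expectation of the nonnegative random variable `deg log deg`, where `0 log 0 = 0`. -/
def meanDegLogDeg (μ : Measure (GStar Ξ Θ)) : ℝ≥0∞ :=
  ∫⁻ g, ENNReal.ofReal ((deg g : ℝ) * Real.log (deg g : ℝ)) ∂μ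

/-! ### The neighborhood empirical measure of a finite marked graph -/

/-- The connected component of a vertex `o` of a locally finite marked graph, rooted at `o`. -/
def MarkedGraph.rootedAt {V : Type} [Countable V] (G : MarkedGraph V Ξ Θ)
    (hG : ∀ v, (G.graph.neighborSet v).Finite) (o : V) : RootedGraph Ξ Θ where
  V := {v | G.graph.Reachable o v}
  G := G.induce {v | G.graph.Reachable o v}
  connected := by
    have h := (G.graph.connectedComponentMk o).maximal_connected_induce_supp.prop
    have e : (G.graph.connectedComponentMk o).supp = {v | G.graph.Reachable o v} := by
      ext v
      simp only [SimpleGraph.ConnectedComponent.mem_supp_iff, SimpleGraph.ConnectedComponent.eq,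
        Set.mem_ofPred_eq]
      exact SimpleGraph.reachable_comm
    rw [e] at h
    exact h
  locallyFinite := finite_neighborSet_induce hG _
  root := ⟨o, SimpleGraph.Reachable.refl o⟩

/-- The law `U(G)` of `[G, v]` for a uniformly chosen vertex `v` of the finite marked graph `G`. -/
def empirical {V : Type} [Fintype V] (G : MarkedGraph V Ξ Θ) : Measure (GStar Ξ Θ) :=
  (Fintype.card V : ℝ≥0∞)⁻¹ •
    ∑ v : V, Measure.dirac (G.rootedAt (fun _ => Set.toFinite _) v).toClass

/-! ### BC entropy -/

/-- The marked graphs on `n` vertices with edge mark count vector `m` and vertex mark count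
vector `u`. -/
def graphsWith (n : ℕ) (m : Ξ → Ξ → ℕ) (u : Θ → ℕ) : Set (MarkedGraph (Fin n) Ξ Θ) :=
  {G | (∀ x x', G.edgeMarkCount x x' = m x x') ∧ ∀ θ, G.vertexMarkCount θ = u θ}

/-- The elements of `graphsWith n m u` whose neighborhood empirical measure is at
Lévy–Prokhorov distance less than `ε` from `μ`. -/
def graphsNear (n : ℕ) (m : Ξ → Ξ → ℕ) (u : Θ → ℕ) (μ : Measure (GStar Ξ Θ)) (ε : ℝ) :
    Set (MarkedGraph (Fin n) Ξ Θ) :=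
  {G | G ∈ graphsWith n m u ∧ levyProkhorovEDist (empirical G) μ < ENNReal.ofReal ε}

/-- `‖m‖₁`, the total number of edges counted by an edge mark count vector. -/
def edgeNorm [Fintype Ξ] [LinearOrder Ξ] (m : Ξ → Ξ → ℕ) : ℕ :=
  ∑ x : Ξ, ∑ x' : Ξ, if x ≤ x' then m x x' else 0

/-- The sequence `(m n, u n)`, `n = 1, 2, …`, consists of edge mark count vectors and vertex mark
count vectors and is adapted to `(d, Q)`. -/
structure Adapted [Fintype Ξ] [LinearOrder Ξ] [Fintype Θ] (d : Ξ → Ξ → ℝ) (Q : Θ → ℝ)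
    (m : ℕ → Ξ → Ξ → ℕ) (u : ℕ → Θ → ℕ) : Prop where
  symm : ∀ n, 0 < n → ∀ x x', m n x x' = m n x' x
  edgeNorm_le : ∀ n, 0 < n → edgeNorm (m n) ≤ n.choose 2
  vertexNorm_eq : ∀ n, 0 < n → ∑ θ, u n θ = n
  tendsto_diag : ∀ x, Tendsto (fun n => (m n x x : ℝ) / n) atTop (𝓝 (d x x / 2))
  tendsto_offDiag : ∀ x x', x ≠ x' → Tendsto (fun n => (m n x x' : ℝ) / n) atTop (𝓝 (d x x'))
  tendsto_vertex : ∀ θ, Tendsto (fun n => (u n θ : ℝ) / n) atTop (𝓝 (Q θ))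
  edge_zero : ∀ x x', d x x' = 0 → ∀ n, 0 < n → m n x x' = 0
  vertex_zero : ∀ θ, Q θ = 0 → ∀ n, 0 < n → u n θ = 0

/-- The `ε`-upper BC entropy of `μ` along the sequences `m` and `u`, with `log 0 = -∞`. -/
def upperEntropyAt [Fintype Ξ] [LinearOrder Ξ] (m : ℕ → Ξ → Ξ → ℕ) (u : ℕ → Θ → ℕ)
    (μ : Measure (GStar Ξ Θ)) (ε : ℝ) : EReal :=
  limsup (fun n : ℕ =>
    (ENNReal.log ((graphsNear n (m n) (u n) μ ε).ncard : ℝ≥0∞)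
      - (((edgeNorm (m n) : ℝ) * Real.log n : ℝ) : EReal)) / (n : EReal)) atTop

/-- The upper BC entropy of `μ` along the sequences `m` and `u`: the limit of the `ε`-upper BC
entropy as `ε` decreases to `0`, which is the infimum over `ε > 0` by monotonicity. -/
def upperEntropy [Fintype Ξ] [LinearOrder Ξ] (m : ℕ → Ξ → Ξ → ℕ) (u : ℕ → Θ → ℕ)
    (μ : Measure (GStar Ξ Θ)) : EReal :=
  ⨅ ε : Set.Ioi (0 : ℝ), upperEntropyAt m u μ ε

theorem upperEntropyAt_mono [Fintype Ξ] [LinearOrder Ξ] [Finite Θ] (m : ℕ → Ξ → Ξ → ℕ)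
    (u : ℕ → Θ → ℕ) (μ : Measure (GStar Ξ Θ)) : Monotone (upperEntropyAt m u μ) := by
  intro a b hab
  refine limsup_le_limsup (Eventually.of_forall fun n => ?_)
  refine EReal.div_le_div_right_of_nonneg (by positivity) (EReal.sub_le_sub ?_ le_rfl)
  refine ENNReal.log_monotone ?_
  have hsub : graphsNear n (m n) (u n) μ a ⊆ graphsNear n (m n) (u n) μ b :=
    fun G hG => ⟨hG.1, hG.2.trans_le (ENNReal.ofReal_le_ofReal hab)⟩
  exact_mod_cast Set.ncard_le_ncard hsub (Set.toFinite _)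

theorem tendsto_upperEntropyAt [Fintype Ξ] [LinearOrder Ξ] [Finite Θ] (m : ℕ → Ξ → Ξ → ℕ)
    (u : ℕ → Θ → ℕ) (μ : Measure (GStar Ξ Θ)) :
    Tendsto (upperEntropyAt m u μ) (𝓝[>] 0) (𝓝 (upperEntropy m u μ)) := by
  have h := (upperEntropyAt_mono m u μ).tendsto_nhdsGT 0
  rwa [sInf_image'] at h

end MarkedBC

end

/-! The entropy is destroyed by degrees alone. Write M for the prescribed number of edges, d for a
degree sequence and t = 1/n.

Give every potential marked edge between v and w the weight t d_v d_w. The product of these weights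
over the edges of a graph with degree sequence d is t^#E ∏ d_v^{d_v}, since each vertex v
contributes d_v once per incident edge. Summed over all edge sets, the products are at most the
exponential of the total weight, which is at most exp(|Ξ|² (2M)²/n). As M = O(n), at most n^M
exp(O(n) − ∑ d_v log d_v) marked graphs have degree sequence d (`card_mul_prod_le`). There are only
exp(O(n)) degree sequences, so summing over them costs nothing at this scale
(`card_le_of_le_sum_mul_log`).

The degree of the root is locally constant for the local metric, so tail probabilities of the degree
pass from μ to Lévy–Prokhorov neighbors with an additive error. Hence E[deg log deg] is lower
semicontinuous, and when it is infinite at μ, every graph close enough to μ satisfies ∑ d_v log d_v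
≥ L n, for any prescribed L (`exists_forall_le_sum_mul_log`). The normalized log-count is then at
most c − L with c independent of L (`ncard_graphsNear_le`), and L is arbitrary. -/

namespace MarkedBC

open Finset

/-! ### Encoding a marked graph by its set of marked edges -/

namespace MarkedGraph

variable {V Ξ Θ : Type*} [Fintype V] [LinearOrder V] [Fintype Ξ]

/-- The degree of a vertex. -/
noncomputable def vertexDegree {V Ξ Θ : Type*} (G : MarkedGraph V Ξ Θ) (v : V) : ℕ :=
  (G.graph.neighborSet v).ncard

open Classical in
/-- The marked edges of `G`, each listed once as its smaller endpoint, its larger endpoint, and the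
marks towards the larger and the smaller endpoint. -/
noncomputable def code (G : MarkedGraph V Ξ Θ) : Finset (V × V × Ξ × Ξ) :=
  {e | e.1 < e.2.1 ∧ G.emark e.1 e.2.1 = some e.2.2.1 ∧ G.emark e.2.1 e.1 = some e.2.2.2}

theorem mem_code {G : MarkedGraph V Ξ Θ} {v w : V} {x y : Ξ} :
    (v, w, x, y) ∈ G.code ↔ v < w ∧ G.emark v w = some x ∧ G.emark w v = some y := by
  simp [code]

theorem exists_emark_eq_some_iff {V Ξ Θ : Type*} (G : MarkedGraph V Ξ Θ) {v w : V} :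
    (∃ x, G.emark v w = some x) ↔ G.graph.Adj v w := by
  rw [← G.emark_isSome, Option.isSome_iff_exists]

/-- An entry of `code` requires both marks of an edge; adjacency is symmetric, so one mark exists
exactly when the other does, and every mark can be read off from `code`. -/
theorem emark_eq_some_iff_of_lt {G : MarkedGraph V Ξ Θ} {v w : V} (h : v < w) (x : Ξ) :
    (G.emark v w = some x ↔ ∃ y, (v, w, x, y) ∈ G.code) ∧
      (G.emark w v = some x ↔ ∃ y, (v, w, y, x) ∈ G.code) := by
  have h1 := G.exists_emark_eq_some_iff (v := v) (w := w)
  have h2 := G.exists_emark_eq_some_iff (v := w) (w := v)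
  rw [G.graph.adj_comm] at h2
  simp only [mem_code, h, true_and, exists_and_left, exists_and_right]
  constructor
  · exact ⟨fun e => ⟨e, h2.2 (h1.1 ⟨x, e⟩)⟩, fun e => e.1⟩
  · exact ⟨fun e => ⟨h1.2 (h2.1 ⟨x, e⟩), e⟩, fun e => e.2⟩

/-- Pairs of distinct vertices are recovered from `code`, and the diagonal carries no marks because
the graph has no loops. Counting graphs thus reduces to counting finite sets of potential edges. -/
theorem vmark_code_injective :
    Function.Injective fun G : MarkedGraph V Ξ Θ => (G.vmark, G.code) := by
  intro G H h
  obtain ⟨h1, h2⟩ := Prod.mk.inj h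
  have h3 : G.emark = H.emark := by
    ext v w x
    rcases lt_trichotomy v w with hlt | rfl | hlt
    · rw [(emark_eq_some_iff_of_lt hlt x).1, (emark_eq_some_iff_of_lt hlt x).1, h2]
    · have hG : ¬ ∃ x, G.emark v v = some x := by simp [G.exists_emark_eq_some_iff]
      have hH : ¬ ∃ x, H.emark v v = some x := by simp [H.exists_emark_eq_some_iff]
      exact ⟨fun e => (hG ⟨x, e⟩).elim, fun e => (hH ⟨x, e⟩).elim⟩
    · rw [(emark_eq_some_iff_of_lt hlt x).2, (emark_eq_some_iff_of_lt hlt x).2, h2]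
  refine MarkedGraph.ext ?_ h1 h3
  ext v w
  rw [← G.emark_isSome, ← H.emark_isSome, h3]

/-- Once the two endpoints are known the marks are determined, so code entries starting at `v`
correspond to the larger neighbors of `v`. -/
theorem card_code_fst (G : MarkedGraph V Ξ Θ) (v : V) :
    #{e ∈ G.code | e.1 = v} = {w | v < w ∧ G.graph.Adj v w}.ncard := by
  classical
  rw [← Set.ncard_coe_finset]
  refine Set.ncard_congr (fun e _ => e.2.1) ?_ ?_ ?_
  · rintro ⟨a, w, x, y⟩ h
    simp only [coe_filter, Set.mem_ofPred_eq, mem_code] at h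
    obtain ⟨⟨h1, h2, -⟩, rfl⟩ := h
    exact ⟨h1, G.exists_emark_eq_some_iff.1 ⟨x, h2⟩⟩
  · rintro ⟨a, w, x, y⟩ ⟨a', w', x', y'⟩ h h' e
    simp only [coe_filter, Set.mem_ofPred_eq, mem_code] at h h' e
    obtain ⟨⟨-, h2, h3⟩, rfl⟩ := h
    obtain ⟨⟨-, h2', h3'⟩, rfl⟩ := h'
    subst e
    simp_all
  · rintro w ⟨h1, h2⟩
    obtain ⟨x, hx⟩ := G.exists_emark_eq_some_iff.2 h2
    obtain ⟨y, hy⟩ := G.exists_emark_eq_some_iff.2 h2.symm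
    exact ⟨(v, w, x, y), by simp [mem_code, *], rfl⟩

theorem card_code_snd (G : MarkedGraph V Ξ Θ) (v : V) :
    #{e ∈ G.code | e.2.1 = v} = {w | w < v ∧ G.graph.Adj v w}.ncard := by
  classical
  rw [← Set.ncard_coe_finset]
  refine Set.ncard_congr (fun e _ => e.1) ?_ ?_ ?_
  · rintro ⟨w, a, x, y⟩ h
    simp only [coe_filter, Set.mem_ofPred_eq, mem_code] at h
    obtain ⟨⟨h1, -, h2⟩, rfl⟩ := h
    exact ⟨h1, G.exists_emark_eq_some_iff.1 ⟨y, h2⟩⟩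
  · rintro ⟨w, a, x, y⟩ ⟨w', a', x', y'⟩ h h' e
    simp only [coe_filter, Set.mem_ofPred_eq, mem_code] at h h' e
    obtain ⟨⟨-, h2, h3⟩, rfl⟩ := h
    obtain ⟨⟨-, h2', h3'⟩, rfl⟩ := h'
    subst e
    simp_all
  · rintro w ⟨h1, h2⟩
    obtain ⟨x, hx⟩ := G.exists_emark_eq_some_iff.2 h2
    obtain ⟨y, hy⟩ := G.exists_emark_eq_some_iff.2 h2.symm
    exact ⟨(w, v, y, x), by simp [mem_code, *], rfl⟩

theorem vertexDegree_eq_card_code (G : MarkedGraph V Ξ Θ) (v : V) :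
    G.vertexDegree v = #{e ∈ G.code | e.1 = v} + #{e ∈ G.code | e.2.1 = v} := by
  rw [card_code_fst, card_code_snd, ← Set.ncard_union_eq ?_ (Set.toFinite _) (Set.toFinite _),
    vertexDegree]
  · congr 1
    ext w
    simp only [SimpleGraph.mem_neighborSet, Set.mem_union, Set.mem_ofPred_eq, ← or_and_right]
    exact ⟨fun h => ⟨lt_or_gt_of_ne h.ne, h⟩, fun h => h.2⟩
  · rw [Set.disjoint_left]
    rintro w ⟨h, -⟩ ⟨h', -⟩
    exact lt_asymm h h'

/-- The handshake lemma in multiplicative form: `p v` occurs once for each edge at `v`. -/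
theorem prod_code (G : MarkedGraph V Ξ Θ) {R : Type*} [CommMonoid R] (p : V → R) :
    ∏ e ∈ G.code, p e.1 * p e.2.1 = ∏ v, p v ^ G.vertexDegree v := by
  rw [prod_mul_distrib, ← prod_fiberwise' G.code (fun e => e.1) p,
    ← prod_fiberwise' G.code (fun e => e.2.1) p, ← prod_mul_distrib]
  refine prod_congr rfl fun v _ => ?_
  rw [prod_const, prod_const, ← pow_add, vertexDegree_eq_card_code]

theorem sum_vertexDegree (G : MarkedGraph V Ξ Θ) : ∑ v, G.vertexDegree v = 2 * #G.code := by
  simp_rw [vertexDegree_eq_card_code, sum_add_distrib]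
  rw [← card_eq_sum_card_fiberwise (by simp), ← card_eq_sum_card_fiberwise (by simp), two_mul]

/-- Sort the two marks of each entry. Entries with the same sorted pair inject into the edges
counted by `edgeMarkCount`, because an ordered pair of endpoints determines its marks. -/
theorem card_code_le [LinearOrder Ξ] (G : MarkedGraph V Ξ Θ) :
    #G.code ≤ edgeNorm G.edgeMarkCount := by
  classical
  rw [edgeNorm, ← Fintype.sum_prod_type' (f := fun x x' : Ξ => if x ≤ x' then
    G.edgeMarkCount x x' else 0), ← sum_filter (fun q : Ξ × Ξ => q.1 ≤ q.2)
    (fun q => G.edgeMarkCount q.1 q.2), card_eq_sum_card_fiberwise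
    (f := fun e : V × V × Ξ × Ξ => (min e.2.2.1 e.2.2.2, max e.2.2.1 e.2.2.2))
    (t := {q : Ξ × Ξ | q.1 ≤ q.2}) fun e _ => by simp]
  refine sum_le_sum fun q _ => ?_
  rw [← Set.ncard_coe_finset, edgeMarkCount]
  refine Set.ncard_le_ncard_of_injOn (fun e => s(e.1, e.2.1)) ?_ ?_ (Set.toFinite _)
  · rintro ⟨v, w, x, y⟩ h
    simp only [coe_filter, Set.mem_ofPred_eq, mem_code] at h
    obtain ⟨⟨-, h1, h2⟩, rfl⟩ := h
    rcases le_total x y with hxy | hxy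
    · exact ⟨v, w, rfl, by simpa [hxy] using h1, by simpa [hxy] using h2⟩
    · exact ⟨w, v, Sym2.eq_swap, by simpa [hxy] using h2, by simpa [hxy] using h1⟩
  · rintro ⟨v, w, x, y⟩ h ⟨v', w', x', y'⟩ h' e
    simp only [coe_filter, Set.mem_ofPred_eq, mem_code] at h h'
    obtain ⟨⟨h1, h2, h3⟩, -⟩ := h
    obtain ⟨⟨h1', h2', h3'⟩, -⟩ := h'
    simp only [Sym2.eq_iff] at e
    rcases e with ⟨rfl, rfl⟩ | ⟨rfl, rfl⟩
    · simp_all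
    · exact (lt_asymm h1 h1').elim

end MarkedGraph

/-! ### Counting marked graphs with large `∑ deg log deg` -/

/-- The sum over all subsets is the expansion of `∏ (1 + x i)`, and `1 + x ≤ exp x`. -/
theorem sum_prod_le_exp {ι : Type*} (S : Finset (Finset ι)) [Fintype ι] (x : ι → ℝ)
    (hx : ∀ i, 0 ≤ x i) : ∑ E ∈ S, ∏ i ∈ E, x i ≤ Real.exp (∑ i, x i) := by
  calc ∑ E ∈ S, ∏ i ∈ E, x i ≤ ∑ E ∈ (univ : Finset ι).powerset, ∏ i ∈ E, x i :=
        sum_le_sum_of_subset_of_nonneg (by simp) fun E _ _ => prod_nonneg fun i _ => hx i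
    _ = ∏ i, (1 + x i) := (prod_one_add _).symm
    _ ≤ ∏ i, Real.exp (x i) := prod_le_prod (fun i _ => by linarith [hx i])
        fun i _ => by linarith [Real.add_one_le_exp (x i)]
    _ = Real.exp (∑ i, x i) := (Real.exp_sum _ _).symm

/-- The number of degree sequences of length `|V|` and total at most `N` is at most
`2 ^ (N + |V|)`. -/
theorem card_degreeSequences_le {V : Type*} [Fintype V] [DecidableEq V] (D : Finset (V → ℕ))
    (N : ℕ) (hD : ∀ d ∈ D, ∑ v, d v ≤ N) : (#D : ℝ) ≤ 2 ^ (N + Fintype.card V) := by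
  have hsub : D ⊆ Fintype.piFinset fun _ => range (N + 1) := fun d hd => by
    rw [Fintype.mem_piFinset]
    intro v
    have := single_le_sum (f := d) (fun i _ => Nat.zero_le _) (mem_univ v)
    have := hD d hd
    rw [mem_range]
    omega
  -- Geometric tilting: an admissible sequence has weight `2 ^ (N - ∑ d v) ≥ 1`, and the total
  -- weight factors over the vertices.
  have h1 : ∀ d ∈ D, (1 : ℝ) ≤ 2 ^ N * ∏ v, (1 / 2 : ℝ) ^ d v := fun d hd => by
    rw [prod_pow_eq_pow_sum, div_pow, one_pow, mul_one_div, le_div_iff₀ (by positivity), one_mul]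
    exact pow_le_pow_right₀ (by norm_num) (hD d hd)
  calc (#D : ℝ) = ∑ d ∈ D, 1 := by simp
    _ ≤ ∑ d ∈ D, 2 ^ N * ∏ v, (1 / 2 : ℝ) ^ d v := sum_le_sum h1
    _ ≤ ∑ d ∈ Fintype.piFinset fun _ => range (N + 1), 2 ^ N * ∏ v, (1 / 2 : ℝ) ^ d v :=
        sum_le_sum_of_subset_of_nonneg hsub fun _ _ _ => by positivity
    _ = 2 ^ N * ∏ v : V, ∑ k ∈ range (N + 1), (1 / 2 : ℝ) ^ k := by
        rw [prod_univ_sum, mul_sum]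
    _ ≤ 2 ^ N * ∏ v : V, 2 := by
        gcongr
        exact sum_geometric_two_le _
    _ = 2 ^ (N + Fintype.card V) := by simp [pow_add]

/-- Marked graphs with a given degree sequence. -/
theorem card_mul_prod_le {V Ξ Θ : Type*} [Fintype V] [LinearOrder V] [Fintype Ξ] [Fintype Θ]
    (S : Finset (MarkedGraph V Ξ Θ)) (d : V → ℕ) (M : ℕ) {t : ℝ} (ht : 0 < t) (ht1 : t ≤ 1)
    (hd : ∀ G ∈ S, G.vertexDegree = d) (hM : ∀ G ∈ S, #G.code ≤ M) :
    #S * (t ^ M * ∏ v, (d v : ℝ) ^ d v) ≤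
      Fintype.card Θ ^ Fintype.card V *
        Real.exp (t * (Fintype.card Ξ ^ 2 * (∑ v, d v : ℕ) ^ 2)) := by
  classical
  -- This weight makes the product over the edges depend on the graph only through its degrees and
  -- number of edges.
  set x : V × V × Ξ × Ξ → ℝ := fun e => t * (d e.1 * d e.2.1) with hx
  have hx0 : ∀ e, 0 ≤ x e := fun e => by positivity
  have hG : ∀ G ∈ S, t ^ M * ∏ v, (d v : ℝ) ^ d v ≤ ∏ e ∈ G.code, x e := fun G h => by
    rw [hx, prod_mul_distrib, prod_const, G.prod_code (fun v => (d v : ℝ)), hd G h]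
    gcongr ?_ * _
    -- As `t ≤ 1`, having at most `M` edges gives `t ^ M ≤ t ^ #G.code`; an upper bound on the
    -- number of edges suffices.
    exact pow_le_pow_of_le_one ht.le ht1 (hM G h)
  -- All ordered pairs are included, also those with `v ≥ w`; the slack makes the sum a perfect
  -- square.
  have hsum : ∑ e, x e = t * (Fintype.card Ξ ^ 2 * (∑ v, d v : ℕ) ^ 2) := by
    simp only [hx, Fintype.sum_prod_type, sum_const, card_univ, nsmul_eq_mul]
    push_cast
    rw [sq (∑ v, (d v : ℝ)), sum_mul_sum]
    simp only [mul_sum]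
    refine sum_congr rfl fun v _ => sum_congr rfl fun w _ => ?_
    rw [Fintype.card_prod]
    push_cast
    ring
  calc #S * (t ^ M * ∏ v, (d v : ℝ) ^ d v) = ∑ G ∈ S, t ^ M * ∏ v, (d v : ℝ) ^ d v := by simp
    _ ≤ ∑ G ∈ S, ∏ e ∈ G.code, x e := sum_le_sum hG
    _ = ∑ q ∈ S.image fun G => (G.vmark, G.code), ∏ e ∈ q.2, x e :=
        (sum_image (f := fun q => ∏ e ∈ q.2, x e) MarkedGraph.vmark_code_injective.injOn).symm
    _ ≤ ∑ q ∈ (univ : Finset (V → Θ)) ×ˢ (univ : Finset (Finset (V × V × Ξ × Ξ))),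
          ∏ e ∈ q.2, x e :=
        sum_le_sum_of_subset_of_nonneg (fun q _ => by simp)
          fun q _ _ => prod_nonneg fun e _ => hx0 e
    _ = Fintype.card Θ ^ Fintype.card V *
          ∑ E : Finset (V × V × Ξ × Ξ), ∏ e ∈ E, x e := by
        rw [sum_product]
        simp
    _ ≤ _ := by
        gcongr
        rw [← hsum]
        exact sum_prod_le_exp _ x hx0

/-- A counting bound for marked graphs in terms of `∑ deg log deg`. -/
theorem card_le_of_le_sum_mul_log {V Ξ Θ : Type*} [Fintype V] [LinearOrder V] [Fintype Ξ]
    [Fintype Θ] (S : Finset (MarkedGraph V Ξ Θ)) (M : ℕ) (L : ℝ) {t : ℝ} (ht : 0 < t)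
    (ht1 : t ≤ 1) (hM : ∀ G ∈ S, #G.code ≤ M)
    (hL : ∀ G ∈ S, L ≤ ∑ v, (G.vertexDegree v : ℝ) * Real.log (G.vertexDegree v)) :
    #S * (t ^ M * Real.exp L) ≤ 2 ^ (2 * M + Fintype.card V) *
      (Fintype.card Θ ^ Fintype.card V *
        Real.exp (t * (Fintype.card Ξ ^ 2 * (2 * M) ^ 2))) := by
  classical
  set D : Finset (V → ℕ) := S.image MarkedGraph.vertexDegree with hDdef
  have hD : ∀ d ∈ D, ∑ v, d v ≤ 2 * M := fun d hd => by
    obtain ⟨G, hG, rfl⟩ := mem_image.1 hd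
    rw [G.sum_vertexDegree]
    exact Nat.mul_le_mul_left 2 (hM G hG)
  have hfib : ∀ d ∈ D, (#{G ∈ S | G.vertexDegree = d} : ℝ) * (t ^ M * Real.exp L) ≤
      Fintype.card Θ ^ Fintype.card V *
        Real.exp (t * (Fintype.card Ξ ^ 2 * (2 * M) ^ 2)) := fun d hd => by
    have hexp : Real.exp L ≤ ∏ v, (d v : ℝ) ^ d v := by
      obtain ⟨G, hG, rfl⟩ := mem_image.1 hd
      refine (Real.exp_le_exp.2 (hL G hG)).trans_eq ?_
      rw [Real.exp_sum]
      refine prod_congr rfl fun v _ => ?_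
      -- Isolated vertices agree by the conventions `0 * log 0 = 0` and `0 ^ 0 = 1`.
      rcases Nat.eq_zero_or_pos (G.vertexDegree v) with h | h
      · simp [h]
      · rw [mul_comm, Real.exp_mul, Real.exp_log (by exact_mod_cast h), Real.rpow_natCast]
    have hs : ((∑ v, d v : ℕ) : ℝ) ≤ 2 * M := by exact_mod_cast hD d hd
    refine le_trans ?_ ((card_mul_prod_le {G ∈ S | G.vertexDegree = d} d M ht ht1
      (fun G h => (mem_filter.1 h).2) fun G h => hM G (mem_filter.1 h).1).trans ?_)
    · gcongr
    · gcongr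
  rw [card_eq_sum_card_fiberwise (f := MarkedGraph.vertexDegree) (t := D)
    fun G hG => mem_image_of_mem _ hG, Nat.cast_sum, sum_mul]
  refine (sum_le_sum hfib).trans ?_
  rw [sum_const, nsmul_eq_mul]
  gcongr
  exact card_degreeSequences_le D (2 * M) hD

end MarkedBC

/-! ### Semicontinuity of degree functionals in the Lévy–Prokhorov distance -/

namespace MarkedBC

theorem deg_trunc_one {Ξ Θ : Type*} (g : GStar Ξ Θ) : deg (g.trunc 1) = deg g := by
  induction g using Quotient.inductionOn with
  | h R =>
    change ((R.ball 1).G.graph.neighborSet (R.ball 1).root).ncard =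
      (R.G.graph.neighborSet R.root).ncard
    refine Set.ncard_congr (fun v _ => v.1) (fun v h => h) (fun v w _ _ h => Subtype.ext h) ?_
    intro w hw
    have hw' : R.G.graph.Adj R.root w := hw
    exact ⟨⟨w, (SimpleGraph.dist_eq_one_iff_adj.2 hw').le⟩, hw, rfl⟩

/-- Distance below `1` means that the neighborhoods of radius `1` agree, and these contain all
neighbors of the root. -/
theorem deg_eq_of_dist_lt_one {Ξ Θ : Type*} {g g' : GStar Ξ Θ} (h : dist g g' < 1) :
    deg g = deg g' := by
  rw [← deg_trunc_one g, ← deg_trunc_one g']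
  congr 1
  change truncDist GStar.trunc g g' < 1 at h
  rw [truncDist] at h
  split_ifs at h with hall
  · exact hall 1
  · set s := {h : ℕ | g.trunc h = g'.trunc h} with hs
    -- In `ℕ`, `sSup` is `0` for empty and for unbounded sets, so a nonzero value excludes both and
    -- the supremum is attained.
    have hpos : sSup s ≠ 0 := fun h0 => by simp [h0] at h
    have hbdd : BddAbove s := by
      by_contra hb
      exact hpos (csSup_of_not_bddAbove hb |>.trans (by simp))
    have hne : s.Nonempty := by
      by_contra he
      rw [Set.not_nonempty_iff_eq_empty] at he
      simp [he] at hpos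
    have hmem : g.trunc (sSup s) = g'.trunc (sSup s) := Nat.sSup_mem hne hbdd
    rw [← GStar.trunc_trunc (Nat.one_le_iff_ne_zero.2 hpos) g, hmem, GStar.trunc_trunc
      (Nat.one_le_iff_ne_zero.2 hpos)]

/-- The degree is constant on open balls of radius `1`, so thickening does not enlarge its level
sets; Lévy–Prokhorov closeness then compares tail probabilities directly. -/
theorem thickening_lt_deg {Ξ Θ : Type*} {δ : ℝ} (hδ : δ ≤ 1) (j : ℕ) :
    Metric.thickening δ {g : GStar Ξ Θ | j < deg g} ⊆ {g | j < deg g} := by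
  intro g hg
  obtain ⟨g', hg', h⟩ := Metric.mem_thickening_iff.1 hg
  simp only [Set.mem_ofPred_eq] at hg' ⊢
  rwa [deg_eq_of_dist_lt_one (h.trans_le hδ)]

theorem measurableSet_lt_deg {Ξ Θ : Type*} (j : ℕ) :
    MeasurableSet {g : GStar Ξ Θ | j < deg g} := by
  refine IsOpen.measurableSet (Metric.isOpen_iff.2 fun g hg => ⟨1, one_pos, fun g' hg' => ?_⟩)
  simp only [Set.mem_ofPred_eq] at hg ⊢
  rwa [deg_eq_of_dist_lt_one (Metric.mem_ball.1 hg')]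

theorem measurable_comp_deg {Ξ Θ : Type*} (φ : ℕ → ℝ≥0∞) :
    Measurable fun g : GStar Ξ Θ => φ (deg g) :=
  (measurable_from_top (f := φ)).comp (measurable_of_Ioi measurableSet_lt_deg)

theorem deg_rootedAt {V : Type} {Ξ Θ : Type*} [Countable V] (G : MarkedGraph V Ξ Θ)
    (hG : ∀ v, (G.graph.neighborSet v).Finite) (v : V) :
    deg (G.rootedAt hG v).toClass = G.vertexDegree v := by
  change ((G.rootedAt hG v).G.graph.neighborSet (G.rootedAt hG v).root).ncard = _
  refine Set.ncard_congr (fun w _ => w.1) (fun w h => h) (fun w w' _ _ h => Subtype.ext h) ?_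
  intro w hw
  have hw' : G.graph.Adj v w := hw
  exact ⟨⟨w, hw'.reachable⟩, hw, rfl⟩

/-- The layers of a function on the natural numbers vanishing at `0`. -/
theorem sum_range_layers (φ : ℕ → ℝ≥0∞) (h0 : φ 0 = 0) (hφ : Monotone φ) (d K : ℕ) :
    ∑ j ∈ Finset.range K, (if j < d then φ (j + 1) - φ j else 0) = φ (min d K) := by
  induction K with
  | zero => simp [h0]
  | succ K ih =>
    rw [Finset.sum_range_succ, ih]
    by_cases h : K < d
    · rw [if_pos h, min_eq_right h.le, min_eq_right (Nat.succ_le_of_lt h),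
        add_tsub_cancel_of_le (hφ K.le_succ)]
    · rw [if_neg h, min_eq_left (by omega), min_eq_left (by omega), add_zero]

/-- Layer-cake formula: truncation at `K` leaves finitely many tail probabilities with nonnegative
coefficients, so errors in the tails add up in a controlled way. -/
theorem lintegral_layers {Ξ Θ : Type*} (ν : Measure (GStar Ξ Θ)) (φ : ℕ → ℝ≥0∞) (h0 : φ 0 = 0)
    (hφ : Monotone φ) (K : ℕ) :
    ∫⁻ g, φ (min (deg g) K) ∂ν =
      ∑ j ∈ Finset.range K, (φ (j + 1) - φ j) * ν {g | j < deg g} := by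
  simp_rw [← sum_range_layers φ h0 hφ]
  have key : ∀ j, (fun g : GStar Ξ Θ => if j < deg g then φ (j + 1) - φ j else 0) =
      {g | j < deg g}.indicator fun _ => φ (j + 1) - φ j := fun j => by
    ext g
    simp [Set.indicator]
  rw [lintegral_finsetSum _ fun j _ => by
    rw [key]
    exact measurable_const.indicator (measurableSet_lt_deg j)]
  refine Finset.sum_congr rfl fun j _ => ?_
  rw [key, lintegral_indicator_const (measurableSet_lt_deg j)]

/-- Lower semicontinuity of the expectation of a function of the degree in the Lévy–Prokhorov
distance. -/
theorem exists_forall_levyProkhorovEDist_lt {Ξ Θ : Type*} (μ : Measure (GStar Ξ Θ)) (φ : ℕ → ℝ≥0∞)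
    (h0 : φ 0 = 0) (hφ : Monotone φ) (htop : ∀ k, φ k ≠ ∞) (hμ : ∫⁻ g, φ (deg g) ∂μ = ∞)
    (L : ℝ≥0) : ∃ ε : ℝ, 0 < ε ∧ ∀ ν : Measure (GStar Ξ Θ),
      levyProkhorovEDist ν μ < ENNReal.ofReal ε → (L : ℝ≥0∞) ≤ ∫⁻ g, φ (deg g) ∂ν := by
  -- Monotone convergence in the truncation level. The extra `1` absorbs the Lévy–Prokhorov error
  -- below.
  obtain ⟨K, hK⟩ : ∃ K, ((L + 1 : ℝ≥0) : ℝ≥0∞) < ∫⁻ g, φ (min (deg g) K) ∂μ := by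
    have hsup : ∀ g : GStar Ξ Θ, φ (deg g) = ⨆ K, φ (min (deg g) K) := fun g =>
      le_antisymm (le_iSup_of_le (deg g) (by simp)) (iSup_le fun K => hφ (min_le_left _ _))
    have hmeas : ∀ K, Measurable fun g : GStar Ξ Θ => φ (min (deg g) K) := fun K =>
      measurable_comp_deg fun k => φ (min k K)
    simp_rw [hsup] at hμ
    rw [lintegral_iSup hmeas fun a b hab g => hφ (min_le_min_left _ hab)] at hμ
    exact lt_iSup_iff.1 (hμ ▸ ENNReal.coe_lt_top)
  set A := (φ K).toNNReal with hA
  have hAK : φ K = A := (ENNReal.coe_toNNReal (htop K)).symm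
  -- Chosen so that `ε ≤ 1`, as thickening requires, and `φ K * ε ≤ 1`, which bounds the total
  -- error.
  refine ⟨1 / (1 + A), by positivity, fun ν hν => ?_⟩
  set ε : ℝ := 1 / (1 + A)
  have hε0 : 0 < ε := by positivity
  have hε1 : ε ≤ 1 := div_le_one_of_le₀ (by linarith [A.coe_nonneg]) (by positivity)
  have hAε : φ K * ENNReal.ofReal ε ≤ 1 := by
    rw [hAK, ← ENNReal.ofReal_coe_nnreal, ← ENNReal.ofReal_mul A.coe_nonneg, ENNReal.ofReal_le_one,
      mul_one_div]
    exact div_le_one_of_le₀ (by linarith) (by positivity)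
  have hlayer : ∀ j, μ {g | j < deg g} ≤ ν {g | j < deg g} + ENNReal.ofReal ε := fun j => by
    refine (right_measure_le_of_levyProkhorovEDist_lt hν (measurableSet_lt_deg j)).trans ?_
    rw [ENNReal.toReal_ofReal hε0.le]
    gcongr
    exact thickening_lt_deg hε1 j
  -- The layer coefficients telescope, so an error `ε` in every tail costs `φ K * ε` in all.
  have hsum : ∑ j ∈ Finset.range K, (φ (j + 1) - φ j) = φ K := by
    rw [← min_self K, ← sum_range_layers φ h0 hφ K K, min_self]
    exact Finset.sum_congr rfl fun j hj => (if_pos (Finset.mem_range.1 hj)).symm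
  have hle : ∫⁻ g, φ (min (deg g) K) ∂μ ≤ ∫⁻ g, φ (deg g) ∂ν + 1 := by
    calc ∫⁻ g, φ (min (deg g) K) ∂μ
        ≤ ∑ j ∈ Finset.range K, (φ (j + 1) - φ j) * (ν {g | j < deg g} + ENNReal.ofReal ε) := by
          rw [lintegral_layers μ φ h0 hφ]
          gcongr with j
          exact hlayer j
      _ = ∫⁻ g, φ (min (deg g) K) ∂ν + φ K * ENNReal.ofReal ε := by
          rw [lintegral_layers ν φ h0 hφ, ← hsum, Finset.sum_mul, ← Finset.sum_add_distrib]
          simp_rw [mul_add]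
      _ ≤ _ := add_le_add (lintegral_mono fun g => hφ (min_le_left _ _)) hAε
  have := hK.le.trans hle
  rw [ENNReal.coe_add, ENNReal.coe_one] at this
  exact (ENNReal.add_le_add_iff_right ENNReal.one_ne_top).1 this

end MarkedBC

/-! ### From the empirical measure to the exponential counting bound -/

namespace MarkedBC

theorem lintegral_empirical {V : Type} {Ξ Θ : Type*} [Fintype V] (G : MarkedGraph V Ξ Θ)
    (φ : ℕ → ℝ≥0∞) : ∫⁻ g, φ (deg g) ∂(empirical G) =
      (Fintype.card V : ℝ≥0∞)⁻¹ * ∑ v, φ (G.vertexDegree v) := by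
  rw [empirical, lintegral_smul_measure, lintegral_finsetSum_measure, smul_eq_mul]
  congr 1
  refine Finset.sum_congr rfl fun v _ => ?_
  rw [lintegral_dirac' _ (measurable_comp_deg φ), deg_rootedAt]

theorem mul_log_natCast_nonneg (k : ℕ) : 0 ≤ (k : ℝ) * Real.log k :=
  mul_nonneg k.cast_nonneg (Real.log_natCast_nonneg k)

theorem monotone_mul_log_natCast : Monotone fun k : ℕ => (k : ℝ) * Real.log k := by
  intro a b hab
  rcases Nat.eq_zero_or_pos a with rfl | ha
  · simpa using mul_log_natCast_nonneg b
  · have h1 : (0 : ℝ) < a := by exact_mod_cast ha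
    have h2 : (a : ℝ) ≤ b := by exact_mod_cast hab
    exact mul_le_mul h2 (Real.log_le_log h1 h2) (Real.log_natCast_nonneg a) b.cast_nonneg

/-- If `E[deg log deg] = ∞`, then graphs whose empirical measure is close to `μ` have large
`∑ deg log deg`. -/
theorem exists_forall_le_sum_mul_log {Ξ Θ : Type*} (μ : Measure (GStar Ξ Θ))
    (hμ : meanDegLogDeg μ = ∞) (L : ℝ≥0) : ∃ ε : ℝ, 0 < ε ∧ ∀ (n : ℕ), 0 < n →
      ∀ G : MarkedGraph (Fin n) Ξ Θ, levyProkhorovEDist (empirical G) μ < ENNReal.ofReal ε →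
        L * n ≤ ∑ v, (G.vertexDegree v : ℝ) * Real.log (G.vertexDegree v) := by
  obtain ⟨ε, hε, h⟩ := exists_forall_levyProkhorovEDist_lt μ
    (fun k : ℕ => ENNReal.ofReal ((k : ℝ) * Real.log k)) (by simp)
    (fun a b hab => ENNReal.ofReal_le_ofReal (monotone_mul_log_natCast hab))
    (fun k => ENNReal.ofReal_ne_top) hμ L
  refine ⟨ε, hε, fun n hn G hG => ?_⟩
  have h1 := h _ hG
  rw [lintegral_empirical G fun k : ℕ => ENNReal.ofReal ((k : ℝ) * Real.log k), Fintype.card_fin,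
    mul_comm, ← div_eq_mul_inv, ENNReal.le_div_iff_mul_le (by simp [hn.ne']) (by simp),
    ← ENNReal.ofReal_sum_of_nonneg fun v _ => mul_log_natCast_nonneg _,
    ← ENNReal.ofReal_coe_nnreal, ← ENNReal.ofReal_natCast, ← ENNReal.ofReal_mul L.coe_nonneg] at h1
  exact (ENNReal.ofReal_le_ofReal_iff
    (Finset.sum_nonneg fun v _ => mul_log_natCast_nonneg _)).1 h1

/-- The edge density `edgeNorm (m n) / n` converges, being a finite sum of convergent terms. -/
theorem Adapted.exists_eventually_edgeNorm_le {Ξ Θ : Type*} [Fintype Ξ] [LinearOrder Ξ] [Fintype Θ]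
    {d : Ξ → Ξ → ℝ} {Q : Θ → ℝ} {m : ℕ → Ξ → Ξ → ℕ} {u : ℕ → Θ → ℕ} (h : Adapted d Q m u) :
    ∃ B : ℕ, ∀ᶠ n in atTop, edgeNorm (m n) ≤ B * n := by
  obtain ⟨c, hc⟩ : ∃ c, Tendsto (fun n => (edgeNorm (m n) : ℝ) / n) atTop (𝓝 c) := by
    refine ⟨∑ x, ∑ x', if x ≤ x' then (if x = x' then d x x / 2 else d x x') else 0, ?_⟩
    simp only [edgeNorm, Nat.cast_sum, Finset.sum_div]
    refine tendsto_finsetSum _ fun x _ => tendsto_finsetSum _ fun x' _ => ?_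
    split_ifs with h1 h2
    · exact h2 ▸ h.tendsto_diag x
    · exact h.tendsto_offDiag x x' h2
    · simp
  obtain ⟨B, hB⟩ := exists_nat_gt c
  refine ⟨B, ?_⟩
  filter_upwards [hc.eventually_lt_const hB, eventually_gt_atTop 0] with n hn hn0
  have hn0' : (0 : ℝ) < n := by exact_mod_cast hn0
  exact_mod_cast ((div_lt_iff₀ hn0').1 hn).le

/-- The counting bound for graphs with a number of edges of order `n`. -/
theorem ncard_graphsNear_le {Ξ Θ : Type*} [Fintype Ξ] [LinearOrder Ξ] [Fintype Θ] {n : ℕ}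
    (hn : 0 < n) (m : Ξ → Ξ → ℕ) (u : Θ → ℕ) (μ : Measure (GStar Ξ Θ)) (ε L : ℝ) (B : ℕ)
    (hB : edgeNorm m ≤ B * n) (hL : ∀ G ∈ graphsNear n m u μ ε,
      L * n ≤ ∑ v, (G.vertexDegree v : ℝ) * Real.log (G.vertexDegree v)) :
    ((graphsNear n m u μ ε).ncard : ℝ) ≤ Real.exp (edgeNorm m * Real.log n +
      n * (2 * B + 1 + Fintype.card Θ + 4 * Fintype.card Ξ ^ 2 * B ^ 2 - L)) := by
  classical
  have hn' : (0 : ℝ) < n := by exact_mod_cast hn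
  have hB' : (edgeNorm m : ℝ) ≤ B * n := by exact_mod_cast hB
  have hfin : (graphsNear n m u μ ε).Finite := Set.toFinite _
  have hmem : ∀ G, G ∈ hfin.toFinset ↔ G ∈ graphsNear n m u μ ε := fun G => hfin.mem_toFinset
  -- With `t = 1 / n`, the factor `t ^ M` produces the normalization `M log n`, while the total
  -- weight, of order `t * M ^ 2`, stays linear in `n`.
  have h := card_le_of_le_sum_mul_log hfin.toFinset (edgeNorm m) (L * n) (t := 1 / (n : ℝ))
    (by positivity) (div_le_one_of_le₀ (by exact_mod_cast hn) hn'.le) (fun G hG => by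
      have := ((hmem G).1 hG).1.1
      rw [← funext fun x => funext fun x' => this x x']
      exact G.card_code_le) fun G hG => hL G ((hmem G).1 hG)
  rw [← Set.ncard_eq_toFinset_card _ hfin, Fintype.card_fin] at h
  have e1 : (1 / (n : ℝ)) ^ edgeNorm m = Real.exp (-(edgeNorm m * Real.log n)) := by
    rw [one_div, inv_pow, Real.exp_neg, mul_comm, Real.exp_mul, Real.exp_log hn',
      Real.rpow_natCast]
  have e2 : (2 : ℝ) ^ (2 * edgeNorm m + n) ≤ Real.exp (n * (2 * B + 1)) := by
    calc (2 : ℝ) ^ (2 * edgeNorm m + n) ≤ Real.exp 1 ^ (2 * edgeNorm m + n) := by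
          gcongr
          linarith [Real.add_one_le_exp 1]
      _ = Real.exp (2 * edgeNorm m + n) := by
          rw [← Real.exp_nat_mul]
          push_cast
          rw [mul_one]
      _ ≤ _ := Real.exp_le_exp.2 (by linarith)
  have e3 : (Fintype.card Θ : ℝ) ^ n ≤ Real.exp (n * Fintype.card Θ) := by
    rw [Real.exp_nat_mul]
    gcongr
    linarith [Real.add_one_le_exp (Fintype.card Θ : ℝ)]
  have e4 : Real.exp (1 / (n : ℝ) * (Fintype.card Ξ ^ 2 * (2 * edgeNorm m) ^ 2)) ≤
      Real.exp (n * (4 * Fintype.card Ξ ^ 2 * B ^ 2)) := by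
    refine Real.exp_le_exp.2 ?_
    calc 1 / (n : ℝ) * (Fintype.card Ξ ^ 2 * (2 * edgeNorm m) ^ 2)
        ≤ 1 / (n : ℝ) * (Fintype.card Ξ ^ 2 * (2 * (B * n)) ^ 2) := by gcongr
      _ = _ := by
        field_simp
        ring
  have h2 := h.trans (mul_le_mul e2 (mul_le_mul e3 e4 (by positivity) (by positivity))
    (by positivity) (by positivity))
  rw [e1, ← Real.exp_add, ← Real.exp_add, ← Real.exp_add, ← le_div_iff₀ (Real.exp_pos _),
    ← Real.exp_sub] at h2
  refine h2.trans_eq (congrArg Real.exp ?_)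
  ring

end MarkedBC

/-! ### Conclusion -/

theorem mainTheorem7 {Ξ : Type*} {Θ : Type*} [Fintype Ξ] [LinearOrder Ξ] [Fintype Θ]
    (μ : Measure (MarkedBC.GStar Ξ Θ)) [IsProbabilityMeasure μ]
    (hμ_tree : ∀ᵐ g ∂μ, g ∈ MarkedBC.TStar Ξ Θ)
    (hμ_unimodular : MarkedBC.Unimodular μ)
    (hdeg_pos : 0 < MarkedBC.meanDeg μ)
    (hdeg_finite : MarkedBC.meanDeg μ < ∞)
    (hdeg_log : MarkedBC.meanDegLogDeg μ = ∞)
    (m : ℕ → Ξ → Ξ → ℕ) (u : ℕ → Θ → ℕ)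
    (hmu : MarkedBC.Adapted (MarkedBC.meanDegVec μ) (MarkedBC.rootMarkLaw μ) m u) :
    MarkedBC.upperEntropy m u μ = ⊥ := by
  rw [EReal.eq_bot_iff_forall_lt]
  intro y
  obtain ⟨B, hB⟩ := hmu.exists_eventually_edgeNorm_le
  set c : ℝ := 2 * B + 1 + Fintype.card Θ + 4 * Fintype.card Ξ ^ 2 * B ^ 2 with hc
  -- This gives `c - L ≤ y - 1`; clipping at `0` can only increase `L`.
  set L : ℝ≥0 := (c - y + 1).toNNReal with hLdef
  have hLc : c - L < y := by linarith [Real.le_coe_toNNReal (c - y + 1)]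
  obtain ⟨ε, hε, hLε⟩ := MarkedBC.exists_forall_le_sum_mul_log μ hdeg_log L
  refine lt_of_le_of_lt ?_ (EReal.coe_lt_coe_iff.2 hLc)
  -- The entropy is an infimum over `ε`, so the single `ε` belonging to `L` is enough.
  refine (iInf_le _ (⟨ε, hε⟩ : Set.Ioi (0 : ℝ))).trans (limsup_le_of_le (by isBoundedDefault) ?_)
  filter_upwards [hB, eventually_gt_atTop 0] with n hBn hn
  have hn' : (0 : EReal) < n := by exact_mod_cast hn
  rw [EReal.div_le_iff_le_mul hn' (EReal.natCast_ne_top n),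
    EReal.sub_le_iff_le_add (Or.inl (EReal.coe_ne_bot _)) (Or.inl (EReal.coe_ne_top _))]
  have hcard := MarkedBC.ncard_graphsNear_le hn (m n) (u n) μ ε L B hBn fun G hG => hLε n hn G hG.2
  rw [← hc] at hcard
  have h1 := ENNReal.log_le_log (ENNReal.ofReal_le_ofReal hcard)
  rw [ENNReal.ofReal_natCast, ENNReal.log_ofReal_of_pos (Real.exp_pos _), Real.log_exp] at h1
  refine h1.trans_eq ?_
  rw [add_comm, EReal.coe_add, EReal.coe_mul, EReal.coe_natCast]
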